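/- Let $X=\{0,1\}$, let $X^*$ be the rooted binary tree of finite words over $X$, and let $a,b,c,d$ be the automorphisms of $X^*$ that fix the empty word and satisfy, for all $w\in X^*$, $$a(0w)=1w,\quad a(1w)=0w,\quad b(0w)=0\,a(w),\quad b(1w)=1\,c(w),$$ $$c(0w)=0\,a(w),\quad c(1w)=1\,d(w),\quad d(0w)=0w,\quad d(1w)=1\,b(w).$$ Let $\mathcal G=\langle a,b,c,d\rangle\le \mathrm{Aut}(X^*)$ be the Grigorchuk group, let $\mathrm{St}_{\mathcal G}(n)$ be the normal subgroup of all $g\in\mathcal G$ that fix every word of length $n$, and put $\mathcal G_n=\mathcal G/\mathrm{St}_{\mathcal G}(n)$. Let $\sigma$ be the endomorphism of the free group on $a,b,c,d$ given by Lysenok's substitution $a\mapsto aca$, $b\mapsto d$, $c\mapsto b$, $d\mapsto c$. **Theorem 1.** For every $n\ge 3$ the group $\mathcal G_n$ has the presentation $$\mathcal G_n=\langle a,b,c,d \mid a^2,\,b^2,\,c^2,\,d^2,\,bcd,\,u_0,\dots,u_{n-3},\,v_0,\dots,v_{n-4},\,w_n,\,t_n\rangle ,$$ where the letters $a,b,c,d$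 stand for the images in $\mathcal G_n$ of the automorphisms $a,b,c,d$, and $$u_i=\sigma^i((ad)^4),\quad v_i=\sigma^i((adacac)^4),\quad w_n=\sigma^{n-3}((ac)^4),\quad t_n=\sigma^{n-3}((abac)^4)$$ (for $n=3$ there are no relators $v_i$). -/

import Mathlib

/-- Automorphisms of the rooted tree `X*` of finite words over the alphabet `X`: bijections of the
set of words that preserve (in both directions) the relation "`u` is a prefix of `v`".  The group
operation is composition, `(f * g) w = f (g w)`. -/
abbrev TreeAut (X : Type*) := RelIso (fun u v : List X => u <+: v) (fun u v : List X => u <+: v)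

/-- Tree automorphisms preserve the level of a vertex. -/
theorem TreeAut.length_apply {X : Type*} (f : TreeAut X) (w : List X) :
    (f w).length = w.length := by
  have hmap : (w.inits.map f).Perm (f w).inits := by
    have hnd : ∀ u : List X, u.inits.Nodup := fun u => by
      induction u with
      | nil => simp
      | cons x u ih =>
        rw [List.inits_cons, List.nodup_cons]
        exact ⟨by simp, ih.map (List.cons_injective)⟩
    rw [List.perm_ext_iff_of_nodup ((hnd w).map f.injective) (hnd (f w))]
    intro u
    rw [List.mem_map, List.mem_inits]
    constructor
    · rintro ⟨v, hv, rfl⟩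
      exact f.map_rel_iff.2 ((List.mem_inits _ _).1 hv)
    · intro hu
      refine ⟨f.symm u, ?_, f.apply_symm_apply u⟩
      rw [List.mem_inits]
      exact f.map_rel_iff.1 (by simpa using hu)
  simpa using hmap.length_eq.symm

/-- The `n`-th level stabilizer `St_G(n)` of a group `G` of tree automorphisms. -/
def levelStabilizer {X : Type*} (G : Subgroup (TreeAut X)) (n : ℕ) : Subgroup G where
  carrier := {g | ∀ w : List X, w.length = n → (g : TreeAut X) w = w}
  one_mem' := fun _ _ => rfl
  mul_mem' := by
    intro g h hg hh w hw
    change (g : TreeAut X) ((h : TreeAut X) w) = w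
    rw [hh w hw, hg w hw]
  inv_mem' := by
    intro g hg w hw
    change (g : TreeAut X).symm w = w
    rw [RelIso.symm_apply_eq, hg w hw]

instance levelStabilizer_normal {X : Type*} (G : Subgroup (TreeAut X)) (n : ℕ) :
    (levelStabilizer G n).Normal where
  conj_mem := by
    intro g hg h w hw
    change (h : TreeAut X) ((g : TreeAut X) ((h : TreeAut X).symm w)) = w
    rw [hg _ ((TreeAut.length_apply (h : TreeAut X).symm w).trans hw), RelIso.apply_symm_apply]

/-- The quotient `G_n = G / St_G(n)`. -/
abbrev LevelQuotient {X : Type*} (G : Subgroup (TreeAut X)) (n : ℕ) : Type _ :=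
  G ⧸ levelStabilizer G n

/-- The four generator symbols. -/
inductive Gen : Type
  | a | b | c | d

/-- The wreath recursion `a = (1,1)σ`, `b = (a,c)`, `c = (a,d)`, `d = (1,b)` on binary words,
the letters `0` and `1` being `false` and `true`. -/
def Gen.act : Gen → List Bool → List Bool
  | _, [] => []
  | .a, x :: w => (!x) :: w
  | .b, false :: w => false :: Gen.act .a w
  | .b, true :: w => true :: Gen.act .c w
  | .c, false :: w => false :: Gen.act .a w
  | .c, true :: w => true :: Gen.act .d w
  | .d, false :: w => false :: w
  | .d, true :: w => true :: Gen.act .b w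

theorem Gen.act_act (g : Gen) (w : List Bool) : g.act (g.act w) = w := by
  induction w generalizing g with
  | nil => cases g <;> simp [Gen.act]
  | cons x w ih => cases g <;> cases x <;> simp [Gen.act, ih]

theorem Gen.act_prefix (g : Gen) {u v : List Bool} (h : u <+: v) : g.act u <+: g.act v := by
  induction u generalizing g v with
  | nil => cases g <;> simp [Gen.act]
  | cons x u ih =>
    cases v with
    | nil => simp at h
    | cons y v =>
      rw [List.cons_prefix_cons] at h
      obtain ⟨rfl, h⟩ := h
      cases g <;> cases x <;> simp [Gen.act, List.cons_prefix_cons, ih _ h, h]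

/-- The tree automorphism given by a generator symbol. -/
def Gen.aut (g : Gen) : TreeAut Bool where
  toFun := g.act
  invFun := g.act
  left_inv := g.act_act
  right_inv := g.act_act
  map_rel_iff' := by
    intro u v
    refine ⟨fun h => ?_, fun h => g.act_prefix h⟩
    have h2 := g.act_prefix h
    change g.act (g.act u) <+: g.act (g.act v) at h2
    rwa [g.act_act, g.act_act] at h2

/-- The Grigorchuk group, generated by the tree automorphisms `a, b, c, d`. -/
def grigorchukGroup : Subgroup (TreeAut Bool) := Subgroup.closure (Set.range Gen.aut)

/-- A generator symbol as an element of the Grigorchuk group. -/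
def Gen.toGrigorchuk (g : Gen) : grigorchukGroup :=
  ⟨g.aut, Subgroup.subset_closure (Set.mem_range_self g)⟩

/-- The letters `a, b, c, d` in the free group on them are `fa, fb, fc, fd`. -/
abbrev fa : FreeGroup Gen := FreeGroup.of Gen.a
abbrev fb : FreeGroup Gen := FreeGroup.of Gen.b
abbrev fc : FreeGroup Gen := FreeGroup.of Gen.c
abbrev fd : FreeGroup Gen := FreeGroup.of Gen.d

/-- Images of the letters under Lysenok's substitution. -/
def lysenokImage : Gen → FreeGroup Gen
  | .a => fa * fc * fa
  | .b => fd
  | .c => fb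
  | .d => fc

/-- Lysenok's substitution `a ↦ aca, b ↦ d, c ↦ b, d ↦ c`, as an endomorphism of the free group. -/
def lysenok : FreeGroup Gen →* FreeGroup Gen := FreeGroup.lift lysenokImage

/-- `u_i = σ^i((ad)^4)`. -/
def relU (i : ℕ) : FreeGroup Gen := lysenok^[i] ((fa * fd) ^ 4)

/-- `v_i = σ^i((adacac)^4)`. -/
def relV (i : ℕ) : FreeGroup Gen := lysenok^[i] ((fa * fd * fa * fc * fa * fc) ^ 4)

/-- `w_n = σ^{n-3}((ac)^4)`, for `n ≥ 3`. -/
def relW (n : ℕ) : FreeGroup Gen := lysenok^[n - 3] ((fa * fc) ^ 4)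

/-- `t_n = σ^{n-3}((abac)^4)`, for `n ≥ 3`. -/
def relT (n : ℕ) : FreeGroup Gen := lysenok^[n - 3] ((fa * fb * fa * fc) ^ 4)

/-- The relators `a², b², c², d², bcd, u_0, …, u_{n-3}, v_0, …, v_{n-4}, w_n, t_n`, for `n ≥ 3`
(for `n = 3` there is no `v_i`). -/
def relators (n : ℕ) : Set (FreeGroup Gen) :=
  {fa ^ 2, fb ^ 2, fc ^ 2, fd ^ 2, fb * fc * fd} ∪ {r | ∃ i, i + 3 ≤ n ∧ r = relU i} ∪
    {r | ∃ i, i + 4 ≤ n ∧ r = relV i} ∪ {relW n, relT n}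

/-- The action of words in the generators on the binary tree. -/
def wordAut : FreeGroup Gen →* TreeAut Bool := FreeGroup.lift Gen.aut

@[simp] theorem wordAut_of (g : Gen) (w : List Bool) : wordAut (FreeGroup.of g) w = g.act w := by
  simp [wordAut, Gen.aut]

@[simp] theorem wordAut_mul (x y : FreeGroup Gen) (w : List Bool) :
    wordAut (x * y) w = wordAut x (wordAut y w) := by
  rw [map_mul]; rfl

@[simp] theorem wordAut_one (w : List Bool) : wordAut 1 w = w := by
  rw [map_one]; rfl

@[simp] theorem wordAut_inv_of (g : Gen) (w : List Bool) :
    wordAut (FreeGroup.of g)⁻¹ w = g.act w := by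
  apply (wordAut (FreeGroup.of g)).injective
  rw [← wordAut_mul]
  simp [Gen.act_act]

@[simp] theorem inv_wordAut_of (g : Gen) (w : List Bool) :
    (wordAut (FreeGroup.of g))⁻¹ w = g.act w := by
  rw [← map_inv, wordAut_inv_of]

theorem wordAut_length (x : FreeGroup Gen) (w : List Bool) :
    (wordAut x w).length = w.length := TreeAut.length_apply _ _

/-- The left coordinate of Lysenok's substitution. -/
def leftCoordinate : FreeGroup Gen →* FreeGroup Gen :=
  FreeGroup.lift fun g => match g with
    | .a => fd
    | .b => 1
    | .c => fa
    | .d => fa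

@[simp] theorem lysenok_of (g : Gen) : lysenok (FreeGroup.of g) = lysenokImage g := by
  simp [lysenok]

theorem wordAut_lysenok_true (x : FreeGroup Gen) (w : List Bool) :
    wordAut (lysenok x) (true :: w) = true :: wordAut x w := by
  induction x using FreeGroup.induction_on generalizing w with
  | C1 => simp
  | of g => cases g <;> simp [lysenokImage, Gen.act]
  | inv_of g _ => cases g <;> simp [lysenokImage, Gen.act]
  | mul x y hx hy => simp [hx, hy]

theorem wordAut_lysenok_false (x : FreeGroup Gen) (w : List Bool) :
    wordAut (lysenok x) (false :: w) = false :: wordAut (leftCoordinate x) w := by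
  induction x using FreeGroup.induction_on generalizing w with
  | C1 => simp
  | of g => cases g <;> simp [lysenokImage, Gen.act, leftCoordinate]
  | inv_of g _ => cases g <;> simp [lysenokImage, Gen.act, leftCoordinate]
  | mul x y hx hy => simp [hx, hy]

/-- In a group generated by two involutions whose product has order dividing four, every element
has order dividing four. -/
theorem pow_four_eq_one_of_mem_closure {G : Type*} [Group G] {s t : G} (hs : s * s = 1)
    (ht : t * t = 1) (hst : (s * t) ^ 4 = 1) {g : G} (hg : g ∈ Subgroup.closure {s, t}) :
    g ^ 4 = 1 := by
  have hs' : s⁻¹ = s := inv_eq_of_mul_eq_one_left hs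
  have ht' : t⁻¹ = t := inv_eq_of_mul_eq_one_left ht
  have hconj : ∀ k : ℤ, s * (s * t) ^ k = (s * t) ^ (-k) * s := by
    intro k
    have h : SemiconjBy s (s * t) (s * t)⁻¹ := by
      simp only [SemiconjBy, mul_inv_rev, hs', ht']
      rw [← mul_assoc, hs, one_mul, mul_assoc, hs, mul_one]
    simpa only [inv_zpow', SemiconjBy] using h.zpow_right k
  have key : ∃ k : ℤ, g = (s * t) ^ k ∨ g = (s * t) ^ k * s := by
    have hsl : ∀ y : G, (∃ k : ℤ, y = (s * t) ^ k ∨ y = (s * t) ^ k * s) →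
        ∃ k : ℤ, s * y = (s * t) ^ k ∨ s * y = (s * t) ^ k * s := by
      rintro y ⟨k, rfl | rfl⟩
      · exact ⟨-k, Or.inr (hconj k)⟩
      · exact ⟨-k, Or.inl (by rw [← mul_assoc, hconj, mul_assoc, hs, mul_one])⟩
    have htl : ∀ y : G, (∃ k : ℤ, y = (s * t) ^ k ∨ y = (s * t) ^ k * s) →
        ∃ k : ℤ, t * y = (s * t) ^ k ∨ t * y = (s * t) ^ k * s := by
      intro y hy
      have h1 : ∃ k : ℤ, (s * t) * y = (s * t) ^ k ∨ (s * t) * y = (s * t) ^ k * s := by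
        obtain ⟨k, rfl | rfl⟩ := hy
        · exact ⟨1 + k, Or.inl (by rw [zpow_add, zpow_one])⟩
        · exact ⟨1 + k, Or.inr (by rw [zpow_add, zpow_one]; simp only [mul_assoc])⟩
      have h2 := hsl _ h1
      rwa [mul_assoc, ← mul_assoc s s, hs, one_mul] at h2
    induction hg using Subgroup.closure_induction_left with
    | one => exact ⟨0, Or.inl (by simp)⟩
    | mul_left x hx y _ ih =>
      rcases hx with rfl | rfl
      · exact hsl _ ih
      · exact htl _ ih
    | inv_mul_cancel x hx y _ ih =>
      rcases hx with rfl | rfl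
      · rw [hs']; exact hsl _ ih
      · rw [ht']; exact htl _ ih
  obtain ⟨k, rfl | rfl⟩ := key
  · rw [← zpow_natCast, ← zpow_mul, mul_comm, zpow_mul, zpow_natCast, hst, one_zpow]
  · have h2 : ((s * t) ^ k * s) * ((s * t) ^ k * s) = 1 := by
      rw [mul_assoc, ← mul_assoc s, hconj, mul_assoc, hs, mul_one, ← zpow_add, add_neg_cancel,
        zpow_zero]
    rw [show 4 = 2 * 2 from rfl, pow_mul, pow_two ((s * t) ^ k * s), h2, one_pow]

theorem wordAut_leftCoordinate_pow_four (x : FreeGroup Gen) :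
    wordAut (leftCoordinate x) ^ 4 = 1 := by
  have hinv : ∀ g : Gen, wordAut (FreeGroup.of g) * wordAut (FreeGroup.of g) = 1 := by
    intro g
    rw [← map_mul]
    ext1 w
    rw [wordAut_mul, wordAut_of, wordAut_of, Gen.act_act]; rfl
  refine pow_four_eq_one_of_mem_closure (s := wordAut fa) (t := wordAut fd) (hinv _) (hinv _) ?_ ?_
  · rw [← map_mul, ← map_pow]
    ext1 w
    change _ = w
    rcases w with _ | ⟨_ | _, w⟩ <;> simp [pow_succ, Gen.act, Gen.act_act]
  · set H := Subgroup.closure {wordAut fa, wordAut fd}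
    have ha : wordAut fa ∈ H := Subgroup.subset_closure (by simp)
    have hd : wordAut fd ∈ H := Subgroup.subset_closure (by simp)
    have hg : ∀ g : Gen, wordAut (leftCoordinate (FreeGroup.of g)) ∈ H := by
      intro g
      cases g
      · simpa [leftCoordinate] using hd
      · simp [leftCoordinate, H.one_mem]
      · simpa [leftCoordinate] using ha
      · simpa [leftCoordinate] using ha
    induction x using FreeGroup.induction_on with
    | C1 => simp [H.one_mem]
    | of g => exact hg g
    | inv_of g _ => rw [map_inv, map_inv]; exact H.inv_mem (hg g)
    | mul x y hx hy => rw [map_mul, map_mul]; exact H.mul_mem hx hy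

/-- The words acting trivially on the `n`-th level. -/
def levelKernel (n : ℕ) : Subgroup (FreeGroup Gen) where
  carrier := {x | ∀ w : List Bool, w.length = n → wordAut x w = w}
  one_mem' := fun w _ => wordAut_one w
  mul_mem' := fun {x y} hx hy w hw => by rw [wordAut_mul, hy w hw, hx w hw]
  inv_mem' := fun {x} hx w hw => by
    apply (wordAut x).injective
    rw [← wordAut_mul, mul_inv_cancel, wordAut_one, hx w hw]

theorem mem_levelKernel {n : ℕ} {x : FreeGroup Gen} :
    x ∈ levelKernel n ↔ ∀ w : List Bool, w.length = n → wordAut x w = w := Iff.rfl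

instance (n : ℕ) : (levelKernel n).Normal where
  conj_mem x hx g w hw := by
    rw [wordAut_mul, wordAut_mul, hx _ (by rw [wordAut_length, hw]), ← wordAut_mul,
      mul_inv_cancel, wordAut_one]

theorem lysenok_pow_four_mem {n : ℕ} {x : FreeGroup Gen} (hx : x ^ 4 ∈ levelKernel n) :
    lysenok x ^ 4 ∈ levelKernel (n + 1) := by
  rintro (_ | ⟨_ | _, w⟩) hw
  · simp at hw
  · rw [← map_pow, wordAut_lysenok_false, map_pow, map_pow, wordAut_leftCoordinate_pow_four]; rfl
  · rw [← map_pow, wordAut_lysenok_true, hx w (by simpa using hw)]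

theorem iterate_lysenok_pow_four_mem {n : ℕ} {x : FreeGroup Gen} (hx : x ^ 4 ∈ levelKernel n)
    (k : ℕ) : lysenok^[k] (x ^ 4) ∈ levelKernel (n + k) := by
  rw [iterate_map_pow]
  induction k with
  | zero => exact hx
  | succ k ih => rw [Function.iterate_succ_apply']; exact lysenok_pow_four_mem ih

theorem relators_subset_levelKernel {n : ℕ} (hn : 3 ≤ n) :
    relators n ⊆ levelKernel n := by
  have hu : ∀ m, (fa * fd) ^ 4 ∈ levelKernel m := by
    rintro m (_ | ⟨_ | _, w⟩) - <;> simp [pow_succ, Gen.act, Gen.act_act]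
  have hv : ∀ m, (fa * fd * fa * fc * fa * fc) ^ 4 ∈ levelKernel m := by
    rintro m (_ | ⟨_ | _, w⟩) - <;> simp [pow_succ, Gen.act, Gen.act_act]
  have hsq : ∀ g : Gen, FreeGroup.of g ^ 2 ∈ levelKernel n := by
    intro g w _; simp [pow_succ, Gen.act_act]
  have hbcd : ∀ w, wordAut (fb * fc * fd) w = w := by
    intro w
    suffices h : ∀ w, Gen.act .b (Gen.act .c (Gen.act .d w)) = w ∧
        Gen.act .c (Gen.act .d (Gen.act .b w)) = w ∧
        Gen.act .d (Gen.act .b (Gen.act .c w)) = w by simpa using (h w).1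
    intro w
    induction w with
    | nil => simp [Gen.act]
    | cons x w ih => cases x <;> simp [Gen.act, Gen.act_act, ih]
  rintro r (((h | ⟨i, hi, rfl⟩) | ⟨i, hi, rfl⟩) | h)
  · rcases h with rfl | rfl | rfl | rfl | rfl
    · exact hsq _
    · exact hsq _
    · exact hsq _
    · exact hsq _
    · exact fun w _ => hbcd w
  · obtain ⟨m, rfl⟩ := Nat.exists_eq_add_of_le' (show i ≤ n by omega)
    exact iterate_lysenok_pow_four_mem (hu m) i
  · obtain ⟨m, rfl⟩ := Nat.exists_eq_add_of_le' (show i ≤ n by omega)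
    exact iterate_lysenok_pow_four_mem (hv m) i
  · obtain ⟨m, rfl⟩ := Nat.exists_eq_add_of_le hn
    have e : 3 + m - 3 = m := by omega
    rcases h with rfl | rfl
    · unfold relW
      rw [e]
      refine iterate_lysenok_pow_four_mem ?_ m
      rintro (_ | ⟨_ | _, _ | ⟨_ | _, _ | ⟨_ | _, _ | _⟩⟩⟩) h <;> simp at h <;>
        simp [pow_succ, Gen.act]
    · unfold relT
      rw [e]
      refine iterate_lysenok_pow_four_mem ?_ m
      rintro (_ | ⟨_ | _, _ | ⟨_ | _, _ | ⟨_ | _, _ | _⟩⟩⟩) h <;> simp at h <;>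
        simp [pow_succ, Gen.act]

theorem normalClosure_relators_le {n : ℕ} (hn : 3 ≤ n) :
    Subgroup.normalClosure (relators n) ≤ levelKernel n :=
  Subgroup.normalClosure_le_normal (relators_subset_levelKernel hn)

theorem commute_of_sq_eq_one {G : Type*} [Group G] {x y : G} (hx : x * x = 1) (hy : y * y = 1)
    (h : x * y * (x * y) = 1) : Commute x y := by
  have hx' : x⁻¹ = x := inv_eq_of_mul_eq_one_left hx
  have hy' : y⁻¹ = y := inv_eq_of_mul_eq_one_left hy
  have := inv_eq_of_mul_eq_one_left h
  rw [mul_inv_rev, hx', hy'] at this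
  exact this.symm

theorem Commute.conj_involution {G : Type*} [Group G] {x y g : G} (h : Commute x y)
    (hg : g * g = 1) : Commute (g * x * g) (g * y * g) := by
  have hg' : g⁻¹ = g := inv_eq_of_mul_eq_one_left hg
  simpa [MulAut.conj_apply, hg'] using h.map (MulAut.conj g)

theorem mem_normalizer_closure_of_involution {G : Type*} [Group G] {s : G} {P : Set G}
    (hs : s * s = 1) (h : ∀ p ∈ P, s * p * s ∈ Subgroup.closure P) :
    s ∈ Subgroup.normalizer (Subgroup.closure P : Set G) := by
  have hs' : s⁻¹ = s := inv_eq_of_mul_eq_one_left hs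
  have key : ∀ x ∈ Subgroup.closure P, s * x * s⁻¹ ∈ Subgroup.closure P := by
    intro x hx
    have : Subgroup.closure P ≤ (Subgroup.closure P).comap (MulAut.conj s).toMonoidHom := by
      rw [Subgroup.closure_le]
      intro p hp
      simpa [hs'] using h p hp
    exact this hx
  rw [Subgroup.mem_normalizer_iff]
  refine fun x => ⟨key x, fun hx => ?_⟩
  have := key _ hx
  rw [hs'] at this
  simpa only [mul_assoc, hs, mul_one, ← mul_assoc s s, one_mul] using this

theorem mul_mul_cancel_of_mul_self {G : Type*} [Group G] {s : G} (hs : s * s = 1) (x : G) :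
    s * (s * x) = x := by rw [← mul_assoc, hs, one_mul]

theorem closure_le_normalizer_closure_of_commute {G : Type*} [Group G] {c d e p : G}
    (hc : c * c = 1) (hd : d * d = 1) (he : e * e = 1)
    (hcd : Commute c d) (hep : Commute e p) (hdp : Commute d p)
    (hec : (e * c) ^ 4 = 1) (hv : Commute p (c * e * d * e * c)) :
    Subgroup.closure {e, d * c, c, d} ≤ Subgroup.normalizer
      (Subgroup.closure {p, c * p * c, e * (c * p * c) * e, c * (e * (c * p * c) * e) * c} : Set G)
      := by
  have hc' := mul_mul_cancel_of_mul_self hc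
  have hd' := mul_mul_cancel_of_mul_self hd
  have he' := mul_mul_cancel_of_mul_self he
  set P : Set G := {p, c * p * c, e * (c * p * c) * e, c * (e * (c * p * c) * e) * c}
  have hcdc : c * d * c = d := by rw [hcd.eq, mul_assoc, hc, mul_one]
  have hdp1 : Commute d (c * p * c) := by
    simpa only [hcdc] using hdp.conj_involution hc
  have hdp2 : Commute d (e * (c * p * c) * e) := by
    have h := ((hv.conj_involution hc).conj_involution he).symm
    simpa only [mul_assoc, hc', he', hc, he, mul_one] using h
  have hdp3 : Commute d (c * (e * (c * p * c) * e) * c) := by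
    simpa only [hcdc] using hdp2.conj_involution hc
  have hece : e * (c * (e * c)) = c * (e * (c * e)) := by
    have h : (e * (c * (e * c))) * (e * (c * (e * c))) = 1 := by
      simpa only [pow_succ, pow_zero, one_mul, mul_assoc] using hec
    have h1 := eq_inv_of_mul_eq_one_left h
    rw [h1]
    simp only [mul_inv_rev, inv_eq_of_mul_eq_one_left hc, inv_eq_of_mul_eq_one_left he, mul_assoc]
  have hece' : ∀ x, e * (c * (e * (c * x))) = c * (e * (c * (e * x))) := fun x => by
    simpa only [mul_assoc] using congrArg (· * x) hece
  have mem0 : p ∈ Subgroup.closure P := Subgroup.subset_closure (by simp [P])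
  have mem1 : c * p * c ∈ Subgroup.closure P := Subgroup.subset_closure (by simp [P])
  have mem2 : e * (c * p * c) * e ∈ Subgroup.closure P := Subgroup.subset_closure (by simp [P])
  have mem3 : c * (e * (c * p * c) * e) * c ∈ Subgroup.closure P :=
    Subgroup.subset_closure (by simp [P])
  have hcN : c ∈ Subgroup.normalizer (Subgroup.closure P : Set G) := by
    refine mem_normalizer_closure_of_involution hc ?_
    rintro x (rfl | rfl | rfl | rfl)
    · exact mem1
    · convert mem0 using 1
      simp only [mul_assoc, hc', hc, mul_one]
    · exact mem3
    · convert mem2 using 1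
      simp only [mul_assoc, hc', hc, mul_one]
  have hdN : d ∈ Subgroup.normalizer (Subgroup.closure P : Set G) := by
    have key : ∀ x, Commute d x → d * x * d = x := fun x h => by
      rw [h.eq, mul_assoc, hd, mul_one]
    refine mem_normalizer_closure_of_involution hd ?_
    rintro x (rfl | rfl | rfl | rfl)
    · rwa [key _ hdp]
    · rwa [key _ hdp1]
    · rwa [key _ hdp2]
    · rwa [key _ hdp3]
  have heN : e ∈ Subgroup.normalizer (Subgroup.closure P : Set G) := by
    refine mem_normalizer_closure_of_involution he ?_
    rintro x (rfl | rfl | rfl | rfl)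
    · rwa [hep.eq, mul_assoc, he, mul_one]
    · exact mem2
    · convert mem1 using 1
      simp only [mul_assoc, he', he, mul_one]
    · convert mem3 using 1
      have h1 : p * (e * (c * (e * c))) = e * (p * (c * (e * c))) := by
        rw [← mul_assoc, ← hep.eq, mul_assoc]
      simp only [mul_assoc]
      rw [hece', ← hece, ← mul_assoc p e, ← hep.eq, mul_assoc, he']
  rw [Subgroup.closure_le]
  rintro x (rfl | rfl | rfl | rfl)
  · exact heN
  · exact mul_mem hdN hcN
  · exact hcN
  · exact hdN

/-- A group satisfying the first relations of the Grigorchuk group is, up to the action of `a`,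
a product of the images of the two "coordinate" subgroups. -/
theorem exists_mul_of_grigorchuk_relations {G : Type*} [Group G] {a b c d : G}
    (ha : a ^ 2 = 1) (hb : b ^ 2 = 1) (hc : c ^ 2 = 1) (hd : d ^ 2 = 1)
    (hbcd : b * c * d = 1) (hu : (a * d) ^ 4 = 1) (hu' : (a * c * a * c) ^ 4 = 1)
    (hv : (a * d * a * c * a * c) ^ 4 = 1)
    {g : G} (hg : g ∈ Subgroup.closure {a, b, c, d}) :
    ∃ s ∈ Subgroup.closure {a * c * a, b, c, d},
      ∃ t ∈ Subgroup.closure {a * d * a, c * (a * d * a) * c,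
          a * c * a * (c * (a * d * a) * c) * (a * c * a),
          c * (a * c * a * (c * (a * d * a) * c) * (a * c * a)) * c},
        g = s * t ∨ a * g = s * t := by
  rw [pow_two] at ha hb hc hd
  have ha' := mul_mul_cancel_of_mul_self ha
  have hc' := mul_mul_cancel_of_mul_self hc
  have hd' := mul_mul_cancel_of_mul_self hd
  obtain rfl : b = d * c := by
    have : b * c * d * (d * c) = d * c := by rw [hbcd, one_mul]
    simpa only [mul_assoc, hd', hc, mul_one] using this
  have hcd : Commute c d := (commute_of_sq_eq_one hd hc hb).symm
  set e := a * c * a with hedef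
  set p := a * d * a with hpdef
  have he : e * e = 1 := by simp only [e, mul_assoc, ha', hc', ha]
  have hp : p * p = 1 := by simp only [p, mul_assoc, ha', hd', ha]
  have he' := mul_mul_cancel_of_mul_self he
  have hep : Commute e p := hcd.conj_involution ha
  have hdp : Commute d p := by
    refine (commute_of_sq_eq_one hp hd ?_).symm
    simpa only [pow_succ, pow_zero, one_mul, mul_assoc, p] using hu
  have hpv : Commute p (c * e * d * e * c) := by
    refine commute_of_sq_eq_one hp ?_ ?_
    · simp only [mul_assoc, hc', he', hd', hc]
    · simpa only [pow_succ, pow_zero, one_mul, mul_assoc, p, e] using hv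
  have hN := closure_le_normalizer_closure_of_commute hc hd he hcd hep hdp hu' hpv
  set S := Subgroup.closure {e, d * c, c, d}
  set T := Subgroup.closure {p, c * p * c, e * (c * p * c) * e, c * (e * (c * p * c) * e) * c}
  have heM : e ∈ S ⊔ T := Subgroup.mem_sup_left (Subgroup.subset_closure (by simp))
  have hcM : c ∈ S ⊔ T := Subgroup.mem_sup_left (Subgroup.subset_closure (by simp))
  have hdM : d ∈ S ⊔ T := Subgroup.mem_sup_left (Subgroup.subset_closure (by simp))
  have hpM : p ∈ S ⊔ T := Subgroup.mem_sup_right (Subgroup.subset_closure (by simp))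
  have hca : a * c = e * a := by simp only [e, mul_assoc, ha, mul_one]
  have hda : a * d = p * a := by simp only [p, mul_assoc, ha, mul_one]
  have key : g ∈ S ⊔ T ∨ a * g ∈ S ⊔ T := by
    have hcl : ∀ y, (y ∈ S ⊔ T ∨ a * y ∈ S ⊔ T) → c * y ∈ S ⊔ T ∨ a * (c * y) ∈ S ⊔ T :=
      fun y => Or.imp (mul_mem hcM) fun h => by
        rw [← mul_assoc, hca, mul_assoc]; exact mul_mem heM h
    have hdl : ∀ y, (y ∈ S ⊔ T ∨ a * y ∈ S ⊔ T) → d * y ∈ S ⊔ T ∨ a * (d * y) ∈ S ⊔ T :=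
      fun y => Or.imp (mul_mem hdM) fun h => by
        rw [← mul_assoc, hda, mul_assoc]; exact mul_mem hpM h
    have hl : ∀ x ∈ ({a, d * c, c, d} : Set G), ∀ y, (y ∈ S ⊔ T ∨ a * y ∈ S ⊔ T) →
        x * y ∈ S ⊔ T ∨ a * (x * y) ∈ S ⊔ T := by
      rintro x (rfl | rfl | rfl | rfl) y hy
      · rw [ha']; exact hy.symm
      · rw [mul_assoc]; exact hdl _ (hcl _ hy)
      · exact hcl _ hy
      · exact hdl _ hy
    have hinv : ∀ x ∈ ({a, d * c, c, d} : Set G), x⁻¹ = x := by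
      rintro x (rfl | rfl | rfl | rfl)
      all_goals exact inv_eq_of_mul_eq_one_left ‹_›
    induction hg using Subgroup.closure_induction_left with
    | one => exact Or.inl (one_mem _)
    | mul_left x hx y _ ih => exact hl x hx y ih
    | inv_mul_cancel x hx y _ ih => rw [hinv x hx]; exact hl x hx y ih
  have hprod : ∀ x ∈ S ⊔ T, ∃ s ∈ S, ∃ t ∈ T, x = s * t := by
    intro x hx
    rw [← SetLike.mem_coe, Subgroup.coe_mul_of_left_le_normalizer_right _ _ hN] at hx
    obtain ⟨s, hs, t, ht, rfl⟩ := hx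
    exact ⟨s, hs, t, ht, rfl⟩
  rcases key with h | h
  · obtain ⟨s, hs, t, ht, h⟩ := hprod _ h
    exact ⟨s, hs, t, ht, Or.inl h⟩
  · obtain ⟨s, hs, t, ht, h⟩ := hprod _ h
    exact ⟨s, hs, t, ht, Or.inr h⟩

theorem normalClosure_relators_le_comap_lysenok {n : ℕ} (hn : 3 ≤ n) :
    Subgroup.normalClosure (relators n) ≤
      (Subgroup.normalClosure (relators (n + 1))).comap lysenok := by
  refine Subgroup.normalClosure_le_normal ?_
  have hmem : ∀ x ∈ relators (n + 1), x ∈ Subgroup.normalClosure (relators (n + 1)) :=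
    fun _ => fun hx => Subgroup.subset_normalClosure hx
  have hb := hmem (fb ^ 2) (by simp [relators])
  have hc := hmem (fc ^ 2) (by simp [relators])
  have hd := hmem (fd ^ 2) (by simp [relators])
  have e : n + 1 - 3 = (n - 3) + 1 := by omega
  rintro r (((h | ⟨i, hi, rfl⟩) | ⟨i, hi, rfl⟩) | h)
  · rw [SetLike.mem_coe, Subgroup.mem_comap]
    rcases h with rfl | rfl | rfl | rfl | rfl
    · have ha := hmem (fa ^ 2) (by simp [relators])
      rw [← PresentedGroup.mk_eq_one_iff] at *
      have ha' := mul_mul_cancel_of_mul_self (by simpa [pow_two] using ha)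
      have hc' := mul_mul_cancel_of_mul_self (by simpa [pow_two] using hc)
      simp only [pow_two, map_mul] at ha
      simp only [pow_two, map_mul, lysenok_of, lysenokImage, mul_assoc, ha', hc', ha]
    · simpa [lysenokImage] using hd
    · simpa [lysenokImage] using hb
    · simpa [lysenokImage] using hc
    · have hbcd := hmem (fb * fc * fd) (by simp [relators])
      have h := Subgroup.normalClosure_normal.conj_mem _ hbcd fd
      simpa [lysenokImage, mul_assoc] using h
  · refine hmem _ (Or.inl (Or.inl (Or.inr ⟨i + 1, by omega, ?_⟩)))
    rw [relU, relU, Function.iterate_succ_apply']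
  · refine hmem _ (Or.inl (Or.inr ⟨i + 1, by omega, ?_⟩))
    rw [relV, relV, Function.iterate_succ_apply']
  · rcases h with rfl | rfl
    · refine hmem _ (Or.inr (Or.inl ?_))
      rw [relW, relW, e, Function.iterate_succ_apply']
    · refine hmem _ (Or.inr (Or.inr ?_))
      rw [Set.mem_singleton_iff, relT, relT, e, Function.iterate_succ_apply']

/-- The substitution `x ↦ a σ(x) a⁻¹`, which acts as `x` on the left subtree. -/
def conjLysenok : FreeGroup Gen →* FreeGroup Gen := (MulAut.conj fa).toMonoidHom.comp lysenok

theorem conjLysenok_apply (x : FreeGroup Gen) : conjLysenok x = fa * lysenok x * fa⁻¹ := rfl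

theorem wordAut_conjLysenok_false (x : FreeGroup Gen) (w : List Bool) :
    wordAut (conjLysenok x) (false :: w) = false :: wordAut x w := by
  simp [conjLysenok_apply, Gen.act, wordAut_lysenok_true]

theorem wordAut_conjLysenok_true (x : FreeGroup Gen) (w : List Bool) :
    wordAut (conjLysenok x) (true :: w) = true :: wordAut (leftCoordinate x) w := by
  simp [conjLysenok_apply, Gen.act, wordAut_lysenok_false]

theorem closure_of_gen : Subgroup.closure {fa, fb, fc, fd} = ⊤ := by
  rw [eq_top_iff, ← FreeGroup.closure_range_of, Subgroup.closure_le]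
  rintro _ ⟨g, rfl⟩
  cases g <;> exact Subgroup.subset_closure (by simp)

/-- The generators of the words whose images under `conjLysenok` are needed. -/
def conjugatesOfB : Set (FreeGroup Gen) :=
  {fb, fa * fb * fa, fd * (fa * fb * fa) * fd, fa * (fd * (fa * fb * fa) * fd) * fa}

theorem wordAut_leftCoordinate_of_mem {x : FreeGroup Gen}
    (hx : x ∈ Subgroup.closure conjugatesOfB) (w : List Bool) :
    wordAut (leftCoordinate x) w = w := by
  have key : ∀ x ∈ conjugatesOfB, ∀ w, wordAut (leftCoordinate x) w = w := by
    rintro x (rfl | rfl | rfl | rfl) w <;> simp [leftCoordinate, Gen.act_act]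
  have : Subgroup.closure conjugatesOfB ≤ (wordAut.comp leftCoordinate).ker := by
    rw [Subgroup.closure_le]
    exact fun x hx => MonoidHom.mem_ker.2 (RelIso.ext (key x hx))
  exact DFunLike.congr_fun (MonoidHom.mem_ker.1 (this hx)) w

theorem levelKernel_succ_le {n : ℕ} (hn : 3 ≤ n)
    (ih : levelKernel n ≤ Subgroup.normalClosure (relators n)) :
    levelKernel (n + 1) ≤ Subgroup.normalClosure (relators (n + 1)) := by
  intro g hg
  set q := PresentedGroup.mk (relators (n + 1)) with hq
  have hrel : ∀ r ∈ relators (n + 1), q r = 1 := fun r hr => PresentedGroup.one_of_mem hr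
  have hker : ∀ x, q x = 1 ↔ x ∈ Subgroup.normalClosure (relators (n + 1)) := fun x =>
    PresentedGroup.mk_eq_one_iff
  have hlys : ∀ x ∈ levelKernel n, q (lysenok x) = 1 := fun x hx =>
    (hker _).2 (normalClosure_relators_le_comap_lysenok hn (ih hx))
  have ha := hrel (fa ^ 2) (by simp [relators])
  have hb := hrel (fb ^ 2) (by simp [relators])
  have hc := hrel (fc ^ 2) (by simp [relators])
  have hd := hrel (fd ^ 2) (by simp [relators])
  have hbcd := hrel (fb * fc * fd) (by simp [relators])
  have hu := hrel (relU 0) (Or.inl (Or.inl (Or.inr ⟨0, by omega, rfl⟩)))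
  have hu' := hrel (relU 1) (Or.inl (Or.inl (Or.inr ⟨1, by omega, rfl⟩)))
  have hv := hrel (relV 0) (Or.inl (Or.inr ⟨0, by omega, rfl⟩))
  rw [relU, Function.iterate_zero_apply] at hu
  rw [relU, Function.iterate_one] at hu'
  rw [relV, Function.iterate_zero_apply] at hv
  simp only [map_pow, map_mul, lysenok_of, lysenokImage] at ha hb hc hd hbcd hu hu' hv
  have hgcl : q g ∈ Subgroup.closure {q fa, q fb, q fc, q fd} := by
    have h : g ∈ Subgroup.closure {fa, fb, fc, fd} := closure_of_gen ▸ Subgroup.mem_top g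
    have := Subgroup.mem_map_of_mem q h
    rwa [MonoidHom.map_closure, Set.image_insert_eq, Set.image_insert_eq, Set.image_pair] at this
  obtain ⟨s, hs, t, ht, hst⟩ :=
    exists_mul_of_grigorchuk_relations ha hb hc hd hbcd hu hu' hv hgcl
  obtain ⟨x, rfl⟩ : ∃ x, q (lysenok x) = s := by
    have hle : Subgroup.closure {q fa * q fc * q fa, q fb, q fc, q fd} ≤
        (q.comp lysenok).range := by
      rw [Subgroup.closure_le]
      rintro _ (rfl | rfl | rfl | rfl)
      · exact ⟨fa, by simp [lysenokImage]⟩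
      · exact ⟨fc, by simp [lysenokImage]⟩
      · exact ⟨fd, by simp [lysenokImage]⟩
      · exact ⟨fb, by simp [lysenokImage]⟩
    exact hle hs
  obtain ⟨y, hy, rfl⟩ : ∃ y ∈ Subgroup.closure conjugatesOfB, q (conjLysenok y) = t := by
    refine (Subgroup.mem_map (f := q.comp conjLysenok)).1 ?_
    rw [MonoidHom.map_closure]
    convert ht using 2
    have haa : q fa * q fa = 1 := by rw [← pow_two, ha]
    have ha' := mul_mul_cancel_of_mul_self haa
    have hai : (q fa)⁻¹ = q fa := inv_eq_of_mul_eq_one_left haa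
    rw [conjugatesOfB, Set.image_insert_eq, Set.image_insert_eq, Set.image_pair]
    simp only [MonoidHom.comp_apply, conjLysenok_apply, map_mul, map_inv, lysenok_of,
      lysenokImage, hai, mul_assoc, ha', haa, mul_one]
  have hact : ∀ z : FreeGroup Gen, q z = 1 → ∀ w : List Bool, w.length = n + 1 →
      wordAut z w = w := fun z hz =>
    normalClosure_relators_le (by omega) ((hker z).1 hz)
  have htrue : ∀ w, wordAut (lysenok x * conjLysenok y) (true :: w) = true :: wordAut x w := by
    intro w
    rw [wordAut_mul, wordAut_conjLysenok_true, wordAut_leftCoordinate_of_mem hy,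
      wordAut_lysenok_true]
  rcases hst with hst | hst
  · have heq : ∀ w : List Bool, w.length = n + 1 →
        wordAut (lysenok x * conjLysenok y) w = w := by
      have h : lysenok x * conjLysenok y * g⁻¹ ∈ levelKernel (n + 1) :=
        hact _ (by rw [map_mul, map_mul, map_inv, hst, mul_inv_cancel])
      have := mul_mem h hg
      rwa [inv_mul_cancel_right] at this
    have hx : x ∈ levelKernel n := fun w hw => by
      have h := heq (true :: w) (by simp [hw])
      rw [htrue] at h
      exact List.tail_eq_of_cons_eq h
    have hx1 := hlys x hx
    have hy' : y ∈ levelKernel n := fun w hw => by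
      have h1 : lysenok x ∈ levelKernel (n + 1) := hact _ hx1
      have h2 := heq (false :: w) (by simp [hw])
      rw [wordAut_mul, wordAut_conjLysenok_false, h1 _ (by simp [wordAut_length, hw])] at h2
      simpa using h2
    rw [← hker, hst, hx1, conjLysenok_apply, map_mul, map_mul, hlys y hy', mul_one, one_mul,
      map_inv, mul_inv_cancel]
  · exfalso
    have h : (fa * g)⁻¹ * (lysenok x * conjLysenok y) ∈ levelKernel (n + 1) :=
      hact _ (by rw [map_mul, map_inv, map_mul q fa, map_mul q (lysenok x), hst, inv_mul_cancel])
    have h2 := h (true :: List.replicate n true) (by simp)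
    rw [wordAut_mul, htrue] at h2
    have h3 := congrArg (wordAut (fa * g)) h2
    rw [← wordAut_mul, mul_inv_cancel, wordAut_one, wordAut_mul, hg _ (by simp)] at h3
    simp [Gen.act] at h3

theorem exists_normal_form {G : Type*} [Group G] {a b c d : G}
    (ha : a ^ 2 = 1) (hb : b ^ 2 = 1) (hc : c ^ 2 = 1) (hd : d ^ 2 = 1)
    (hbcd : b * c * d = 1) (hu : (a * d) ^ 4 = 1) (hw : (a * c) ^ 4 = 1)
    (ht : (a * b * a * c) ^ 4 = 1) {g : G} (hg : g ∈ Subgroup.closure {a, b, c, d}) :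
    ∃ o i j k l m n : ℕ, g = a ^ o * (d ^ i * (a * c * a * d * (a * c * a)) ^ j *
      (a * d * a) ^ k * (c * (a * d * a) * c) ^ l * c ^ m * (a * c * a) ^ n) := by
  rw [pow_two] at ha hb hc hd
  have ha' := mul_mul_cancel_of_mul_self ha
  have hc' := mul_mul_cancel_of_mul_self hc
  have hd' := mul_mul_cancel_of_mul_self hd
  obtain rfl : b = d * c := by
    have : b * c * d * (d * c) = d * c := by rw [hbcd, one_mul]
    simpa only [mul_assoc, hd', hc, mul_one] using this
  have hcd : Commute c d := (commute_of_sq_eq_one hd hc hb).symm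
  set e := a * c * a with hedef
  set p := a * d * a with hpdef
  have he : e * e = 1 := by simp only [e, mul_assoc, ha', hc', ha]
  have hp : p * p = 1 := by simp only [p, mul_assoc, ha', hd', ha]
  have he' := mul_mul_cancel_of_mul_self he
  have hp' := mul_mul_cancel_of_mul_self hp
  have hep : Commute e p := hcd.conj_involution ha
  have hdp : Commute d p := by
    refine (commute_of_sq_eq_one hp hd ?_).symm
    simpa only [pow_succ, pow_zero, one_mul, mul_assoc, p] using hu
  have hce : Commute c e := by
    refine (commute_of_sq_eq_one he hc ?_).symm
    simpa only [pow_succ, pow_zero, one_mul, mul_assoc, e] using hw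
  set r := e * d * e with hrdef
  set q := c * p * c with hqdef
  have hca : c * a = a * e := by simp only [e, mul_assoc, ha']
  have hda : d * a = a * p := by simp only [p, mul_assoc, ha']
  have hcp : SemiconjBy c p q := by simp only [SemiconjBy, q, mul_assoc, hc, mul_one]
  have hcq : SemiconjBy c q p := by simp only [SemiconjBy, q, mul_assoc, hc']
  have hed : SemiconjBy e d r := by simp only [SemiconjBy, r, mul_assoc, he, mul_one]
  have her : SemiconjBy e r d := by simp only [SemiconjBy, r, mul_assoc, he']
  have hcec : c * e * c = e := by rw [hce.eq, mul_assoc, hc, mul_one]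
  have hece : e * c * e = c := by rw [← hce.eq, mul_assoc, he, mul_one]
  have hepe : e * p * e = p := by rw [hep.eq, mul_assoc, he, mul_one]
  have hcr : Commute c r := by simpa only [hece] using hcd.conj_involution he
  have heq : Commute e q := by simpa only [hcec] using hep.conj_involution hc
  have hrp : Commute r p := by simpa only [hepe] using hdp.conj_involution he
  have hpq : Commute p q := by
    refine commute_of_sq_eq_one hp (by simp only [q, mul_assoc, hc', hp', hc]) ?_
    have h : a * (d * c) * a * c = e * p * c := by
      simp only [e, p, mul_assoc, ha', ← hcd.eq]
    have h2 : (e * p * c) * (e * p * c) = p * q := by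
      have : c * (e * (p * c)) = e * (c * (p * c)) := by rw [← mul_assoc, hce.eq, mul_assoc]
      simp only [q, mul_assoc]
      rw [this, ← mul_assoc p e, ← hep.eq, mul_assoc e p, he']
    rw [h, show 4 = 2 * 2 from rfl, pow_mul, pow_two (e * p * c), h2, pow_two] at ht
    exact ht
  have hdr : Commute d r := by
    have h1 : a * p * a = d := by simp only [p, mul_assoc, ha', ha, mul_one]
    have h2 : a * q * a = r := by simp only [q, r, p, e, mul_assoc]
    simpa only [h1, h2] using hpq.conj_involution ha
  set N : Set G := {x | ∃ i j k l m n : ℕ, x = d ^ i * r ^ j * p ^ k * q ^ l * c ^ m * e ^ n}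
  have hdN : ∀ x ∈ N, d * x ∈ N := by
    rintro _ ⟨i, j, k, l, m, n, rfl⟩
    refine ⟨i + 1, j, k, l, m, n, ?_⟩
    simp only [pow_succ', mul_assoc]
  have hpN : ∀ x ∈ N, p * x ∈ N := by
    rintro _ ⟨i, j, k, l, m, n, rfl⟩
    refine ⟨i, j, k + 1, l, m, n, ?_⟩
    have h := (hdp.symm.pow_right i).mul_right (hrp.symm.pow_right j)
    rw [pow_succ', ← mul_assoc _ p, ← h.eq]
    simp only [mul_assoc]
  have hcN : ∀ x ∈ N, c * x ∈ N := by
    rintro _ ⟨i, j, k, l, m, n, rfl⟩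
    refine ⟨i, j, l, k, m + 1, n, ?_⟩
    have h := SemiconjBy.mul_right (SemiconjBy.mul_right ((hcd.pow_right i).mul_right (hcr.pow_right j))
      (hcp.pow_right k)) (hcq.pow_right l)
    have h2 := (hpq.pow_pow l k).eq
    simp only [← mul_assoc]
    simp only [SemiconjBy, ← mul_assoc] at h
    rw [h, pow_succ', mul_assoc (d ^ i * r ^ j), ← h2]
    simp only [mul_assoc]
  have heN : ∀ x ∈ N, e * x ∈ N := by
    rintro _ ⟨i, j, k, l, m, n, rfl⟩
    refine ⟨j, i, k, l, m, n + 1, ?_⟩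
    have h := ((((hed.pow_right i).mul_right (her.pow_right j)).mul_right
      (hep.pow_right k)).mul_right (heq.pow_right l)).mul_right (hce.symm.pow_right m)
    have h2 := (hdr.symm.pow_pow i j).eq
    rw [← mul_assoc, h.eq, h2, pow_succ', mul_assoc]
  set M : Set G := {x | ∃ o : ℕ, ∃ y ∈ N, x = a ^ o * y}
  have haM : ∀ x ∈ M, a * x ∈ M := by
    rintro _ ⟨o, y, hy, rfl⟩
    exact ⟨o + 1, y, hy, by rw [pow_succ', mul_assoc]⟩
  have hswap : ∀ s t, s * a = a * t → t * a = a * s → (∀ x ∈ N, s * x ∈ N) →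
      (∀ x ∈ N, t * x ∈ N) → ∀ x ∈ M, s * x ∈ M := by
    rintro s t hst hts hs ht _ ⟨o, y, hy, rfl⟩
    induction o generalizing s t with
    | zero => exact ⟨0, s * y, hs y hy, by simp⟩
    | succ o ih =>
      have := haM _ (ih t s hts hst ht hs)
      rwa [← mul_assoc, ← hst, mul_assoc, ← mul_assoc a, ← pow_succ'] at this
  have hcM := hswap c e hca (by simp only [e, mul_assoc, ha, mul_one]) hcN heN
  have hdM := hswap d p hda (by simp only [p, mul_assoc, ha, mul_one]) hdN hpN
  have hl : ∀ x ∈ ({a, d * c, c, d} : Set G), ∀ y ∈ M, x * y ∈ M := by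
    rintro x (rfl | rfl | rfl | rfl) y hy
    · exact haM _ hy
    · rw [mul_assoc]; exact hdM _ (hcM _ hy)
    · exact hcM _ hy
    · exact hdM _ hy
  have hinv : ∀ x ∈ ({a, d * c, c, d} : Set G), x⁻¹ = x := by
    rintro x (rfl | rfl | rfl | rfl)
    all_goals exact inv_eq_of_mul_eq_one_left ‹_›
  have key : g ∈ M := by
    induction hg using Subgroup.closure_induction_left with
    | one => exact ⟨0, 1, ⟨0, 0, 0, 0, 0, 0, by simp⟩, by simp⟩
    | mul_left x hx y _ ih => exact hl x hx y ih
    | inv_mul_cancel x hx y _ ih => rw [hinv x hx]; exact hl x hx y ih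
  obtain ⟨o, _, ⟨i, j, k, l, m, n, rfl⟩, rfl⟩ := key
  exact ⟨o, i, j, k, l, m, n, rfl⟩

theorem wordAut_pow (x : FreeGroup Gen) (k : ℕ) (w : List Bool) :
    wordAut (x ^ k) w = (wordAut x)^[k] w := by
  induction k with
  | zero => simp
  | succ k ih => rw [pow_succ', wordAut_mul, ih, Function.iterate_succ_apply']

/-- The words representing the elements of the third level quotient. -/
def normalWord (o i j k l m n : ℕ) : FreeGroup Gen :=
  fa ^ o * (fd ^ i * (fa * fc * fa * fd * (fa * fc * fa)) ^ j *
      (fa * fd * fa) ^ k * (fc * (fa * fd * fa) * fc) ^ l * fc ^ m * (fa * fc * fa) ^ n)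

/-- The action of `normalWord`. -/
def normalAct (o i j k l m n : ℕ) (w : List Bool) : List Bool :=
  (Gen.act .a)^[o] <| (Gen.act .d)^[i] <|
  (fun w => Gen.act .a <| Gen.act .c <| Gen.act .a <| Gen.act .d <| Gen.act .a <| Gen.act .c <|
    Gen.act .a w)^[j] <|
  (fun w => Gen.act .a <| Gen.act .d <| Gen.act .a w)^[k] <|
  (fun w => Gen.act .c <| Gen.act .a <| Gen.act .d <| Gen.act .a <| Gen.act .c w)^[l] <|
  (Gen.act .c)^[m] <|
  (fun w => Gen.act .a <| Gen.act .c <| Gen.act .a w)^[n] w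

theorem wordAut_normalWord (o i j k l m n : ℕ) (w : List Bool) :
    wordAut (normalWord o i j k l m n) w = normalAct o i j k l m n w := by
  have h : ∀ x : FreeGroup Gen, ∀ f, (∀ w, wordAut x w = f w) → ⇑(wordAut x) = f :=
    fun _ _ => funext
  rw [normalWord, normalAct]
  simp only [wordAut_mul, wordAut_pow]
  rw [h fa _ (wordAut_of _), h fd _ (wordAut_of _), h fc _ (wordAut_of _),
    h (fa * fc * fa * fd * (fa * fc * fa)) _ fun w => by simp only [wordAut_mul, wordAut_of]; rfl,
    h (fa * fd * fa) _ fun w => by simp only [wordAut_mul, wordAut_of]; rfl,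
    h (fc * (fa * fd * fa) * fc) _ fun w => by simp only [wordAut_mul, wordAut_of]; rfl,
    h (fa * fc * fa) _ fun w => by simp only [wordAut_mul, wordAut_of]; rfl]

set_option synthInstance.maxHeartbeats 400000 in
set_option synthInstance.maxSize 4000 in
theorem eq_zero_of_normalAct : ∀ o i j k l m n : Fin 2,
    (∀ x y z : Bool, normalAct o i j k l m n [x, y, z] = [x, y, z]) →
    o = 0 ∧ i = 0 ∧ j = 0 ∧ k = 0 ∧ l = 0 ∧ m = 0 ∧ n = 0 := by
  decide +kernel

theorem levelKernel_three_le : levelKernel 3 ≤ Subgroup.normalClosure (relators 3) := by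
  intro g hg
  set q := PresentedGroup.mk (relators 3) with hq
  have hrel : ∀ r ∈ relators 3, q r = 1 := fun r hr => PresentedGroup.one_of_mem hr
  have hker : ∀ x, q x = 1 ↔ x ∈ Subgroup.normalClosure (relators 3) := fun x =>
    PresentedGroup.mk_eq_one_iff
  have ha := hrel (fa ^ 2) (by simp [relators])
  have hb := hrel (fb ^ 2) (by simp [relators])
  have hc := hrel (fc ^ 2) (by simp [relators])
  have hd := hrel (fd ^ 2) (by simp [relators])
  have hbcd := hrel (fb * fc * fd) (by simp [relators])
  have hu := hrel (relU 0) (Or.inl (Or.inl (Or.inr ⟨0, by omega, rfl⟩)))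
  have hw := hrel (relW 3) (Or.inr (Or.inl rfl))
  have ht := hrel (relT 3) (Or.inr (Or.inr rfl))
  rw [relU, Function.iterate_zero_apply] at hu
  rw [relW, Nat.sub_self, Function.iterate_zero_apply] at hw
  rw [relT, Nat.sub_self, Function.iterate_zero_apply] at ht
  simp only [map_pow, map_mul] at ha hb hc hd hbcd hu hw ht
  have hgcl : q g ∈ Subgroup.closure {q fa, q fb, q fc, q fd} := by
    have h : g ∈ Subgroup.closure {fa, fb, fc, fd} := closure_of_gen ▸ Subgroup.mem_top g
    have := Subgroup.mem_map_of_mem q h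
    rwa [MonoidHom.map_closure, Set.image_insert_eq, Set.image_insert_eq, Set.image_pair] at this
  obtain ⟨o, i, j, k, l, m, n, hform⟩ := exists_normal_form ha hb hc hd hbcd hu hw ht hgcl
  have ha' := mul_mul_cancel_of_mul_self (pow_two (q fa) ▸ ha)
  have hc' := mul_mul_cancel_of_mul_self (pow_two (q fc) ▸ hc)
  have hd' := mul_mul_cancel_of_mul_self (pow_two (q fd) ▸ hd)
  have hmod : ∀ x : PresentedGroup (relators 3), x ^ 2 = 1 → ∀ k : ℕ,
      x ^ k = x ^ (Fin.ofNat 2 k : Fin 2).val := by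
    intro x hx k
    rw [Fin.val_ofNat]
    exact pow_eq_pow_mod k hx
  have hform' : q g = q (normalWord (Fin.ofNat 2 o : Fin 2).val (Fin.ofNat 2 i : Fin 2).val
      (Fin.ofNat 2 j : Fin 2).val (Fin.ofNat 2 k : Fin 2).val (Fin.ofNat 2 l : Fin 2).val
      (Fin.ofNat 2 m : Fin 2).val (Fin.ofNat 2 n : Fin 2).val) := by
    rw [hform, normalWord]
    simp only [map_mul, map_pow]
    rw [pow_two] at ha hc hd
    rw [← hmod (q fa), ← hmod (q fd), ← hmod (q fc), ← hmod (q fa * q fc * q fa),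
      ← hmod (q fa * q fd * q fa), ← hmod (q fc * (q fa * q fd * q fa) * q fc),
      ← hmod (q fa * q fc * q fa * q fd * (q fa * q fc * q fa))]
    all_goals simp only [pow_two, mul_assoc, ha', hc', hd', ha, hc, hd]
  generalize Fin.ofNat 2 o = o, Fin.ofNat 2 i = i, Fin.ofNat 2 j = j, Fin.ofNat 2 k = k,
    Fin.ofNat 2 l = l, Fin.ofNat 2 m = m, Fin.ofNat 2 n = n at hform'
  have hmem : normalWord o i j k l m n ∈ levelKernel 3 := by
    have h : normalWord o i j k l m n * g⁻¹ ∈ levelKernel 3 :=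
      normalClosure_relators_le le_rfl
        ((hker _).1 (by rw [map_mul, map_inv, hform', mul_inv_cancel]))
    simpa using mul_mem h hg
  obtain ⟨rfl, rfl, rfl, rfl, rfl, rfl, rfl⟩ := eq_zero_of_normalAct o i j k l m n
    fun x y z => by rw [← wordAut_normalWord]; exact hmem _ rfl
  rw [← hker, hform']
  simp [normalWord]

theorem levelKernel_eq_normalClosure {n : ℕ} (hn : 3 ≤ n) :
    levelKernel n = Subgroup.normalClosure (relators n) := by
  refine le_antisymm ?_ (normalClosure_relators_le hn)
  induction n, hn using Nat.le_induction with
  | base => exact levelKernel_three_le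
  | succ n hn ih => exact levelKernel_succ_le hn ih

/-- Words in the generators as elements of the Grigorchuk group. -/
def wordGrigorchuk : FreeGroup Gen →* grigorchukGroup := FreeGroup.lift Gen.toGrigorchuk

theorem coe_wordGrigorchuk (x : FreeGroup Gen) : (wordGrigorchuk x : TreeAut Bool) = wordAut x := by
  have : grigorchukGroup.subtype.comp wordGrigorchuk = wordAut :=
    FreeGroup.ext_hom _ _ fun g => by simp [wordGrigorchuk, wordAut, Gen.toGrigorchuk]
  exact DFunLike.congr_fun this x

theorem wordGrigorchuk_surjective : Function.Surjective wordGrigorchuk := by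
  rintro ⟨g, hg⟩
  have h : grigorchukGroup ≤ wordAut.range := by
    rw [grigorchukGroup, Subgroup.closure_le]
    rintro _ ⟨g, rfl⟩
    exact ⟨FreeGroup.of g, by simp [wordAut]⟩
  obtain ⟨x, rfl⟩ := h hg
  exact ⟨x, Subtype.ext (coe_wordGrigorchuk x)⟩

/-- For `n ≥ 3` the quotient `G_n` of the Grigorchuk group has the presentation with generators
`a, b, c, d` and the above relators, the letters standing for the images in `G_n` of the
automorphisms they name. -/
theorem theorem1 (n : ℕ) (hn : 3 ≤ n) :
    ∃ e : PresentedGroup (relators n) ≃* LevelQuotient grigorchukGroup n,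
      ∀ g : Gen, e (PresentedGroup.of g) = QuotientGroup.mk g.toGrigorchuk := by
  let f : FreeGroup Gen →* LevelQuotient grigorchukGroup n :=
    (QuotientGroup.mk' (levelStabilizer grigorchukGroup n)).comp wordGrigorchuk
  have hf : Function.Surjective f :=
    (QuotientGroup.mk'_surjective _).comp wordGrigorchuk_surjective
  have hker : Subgroup.normalClosure (relators n) = f.ker := by
    rw [← levelKernel_eq_normalClosure hn]
    ext x
    rw [MonoidHom.mem_ker, MonoidHom.comp_apply, QuotientGroup.mk'_apply,
      QuotientGroup.eq_one_iff, mem_levelKernel]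
    change _ ↔ ∀ w : List Bool, w.length = n → (wordGrigorchuk x : TreeAut Bool) w = w
    rw [coe_wordGrigorchuk]
  refine ⟨(QuotientGroup.quotientMulEquivOfEq hker).trans
    (QuotientGroup.quotientKerEquivOfSurjective f hf), fun g => ?_⟩
  change f (FreeGroup.of g) = _
  simp [f, wordGrigorchuk]
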